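/- Let $\mathcal N=\{1,\dots,n\}$ be a set of products, let $\mathcal S$ be a finite collection of assortments $S\subseteq\mathcal N$, and let $\boldsymbol p_{\mathcal S}=(p_{i,S}: i\in S,\ S\in\mathcal S)$ be choice data, i.e. $p_{i,S}\ge 0$ and $\sum_{i\in S}p_{i,S}=1$ for every $S\in\mathcal S$. Call $\boldsymbol p_{\mathcal S}$ representable by a marginal distribution model (MDM) if there are deterministic utilities $\nu_1,\dots,\nu_n\in\mathbb R$ and probability distributions $F_1,\dots,F_n$ on $\mathbb R$, each absolutely continuous, with distribution function strictly increasing on its support and with finite first absolute moment, such that for every $S\in\mathcal S$ there is a joint distribution $\theta^*$ of $(\tilde\epsilon_1,\dots,\tilde\epsilon_n)$ with marginals $F_1,\dots,F_n$ that maximizes $\mathbb E_{\tilde{\boldsymbol\epsilon}\sim\theta}\big[\max_{i\in S}(\nu_i+\tilde\epsilon_i)\big]$ over all joint distributions $\theta$ with these marginals, and for which $p_{i,S}=\mathbb P_{\theta^*}\big(i=\arg\max_{j\in S}(\nu_j+\tilde\epsilon_j)\big)$ for all $i\in S$. Then $\boldsymbol p_{\mathcal S}$ is representable by an MDM if and only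 if there exists a function $\lambda:\mathcal S\to\mathbb R$ such that for any two assortments $S,T\in\mathcal S$ containing a common product $i$: $$\lambda(S)>\lambda(T)\ \text{ if } p_{i,S}<p_{i,T},\qquad \lambda(S)=\lambda(T)\ \text{ if } p_{i,S}=p_{i,T}\neq 0.$$ As a result, whether $\boldsymbol p_{\mathcal S}$ is representable by an MDM can be checked by solving a linear program with $|\mathcal S|+1=\mathcal O(|\mathcal S|)$ continuous variables and at most $n|\mathcal S|$ constraints: $\boldsymbol p_{\mathcal S}$ is representable if and only if the optimal value of the following program is strictly positive. The variables are $\lambda_S$ $(S\in\mathcal S)$ and $\epsilon$; the objective is to maximize $\epsilon$. For each product $i$, list the assortments of $\mathcal S$ containing $i$ in non-increasing order of choice probability, $p_{i,S_1}\ge\dots\ge p_{i,S_l}>0=p_{i,S_{l+1}}=\dots=p_{i,S_m}$. If $l\ge1$, impose, for $1\le k<l$, the constraint $\lambda_{S_{k+1}}-\lambda_{S_k}\ge\epsilon$ if $p_{i,S_{k+1}}<p_{i,S_k}$ and $\lambda_{S_{k+1}}=\lambda_{S_k}$ if $p_{i,S_{k+1}}=p_{i,S_k}$, and, for $l<k\le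 m$, the constraint $\lambda_{S_k}-\lambda_{S_l}\ge\epsilon$. -/

import Mathlib

open MeasureTheory ProbabilityTheory

noncomputable section

/-! ## Choice data -/

/-- `p i S` is the fraction of the population choosing product `i` from the assortment `S`.
Only the values with `S ∈ 𝒮` and `i ∈ S` are data; the other values are never used. -/
def IsChoiceData {n : ℕ} (𝒮 : Finset (Finset (Fin n))) (p : Fin n → Finset (Fin n) → ℝ) : Prop :=
  ∀ S ∈ 𝒮, (∀ i ∈ S, 0 ≤ p i S) ∧ ∑ i ∈ S, p i S = 1

/-! ## The marginal distribution model -/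

/-- The standing assumption on the marginal law `μ` of a random utility term: it is an absolutely
continuous probability law, its distribution function is strictly increasing on its support, and
it has a finite first absolute moment. -/
structure IsAdmissibleMarginal (μ : Measure ℝ) : Prop where
  isProbabilityMeasure : IsProbabilityMeasure μ
  absolutelyContinuous : μ ≪ volume
  strictMonoOn_cdf : StrictMonoOn (cdf μ) μ.support
  integrable : Integrable (fun x : ℝ => x) μ

/-- The set of all joint laws of `(ε₁, …, εₙ)` with the given marginal laws `F₁, …, Fₙ`. -/
def jointLaws {n : ℕ} (F : Fin n → Measure ℝ) : Set (Measure (Fin n → ℝ)) :=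
  {θ | IsProbabilityMeasure θ ∧ ∀ i, θ.map (fun e => e i) = F i}

/-- The expected maximal utility `𝔼_θ [max_{i ∈ S} (νᵢ + εᵢ)]`. -/
def expectedMaxUtility {n : ℕ} (ν : Fin n → ℝ) (S : Finset (Fin n))
    (θ : Measure (Fin n → ℝ)) : ℝ :=
  ∫ e, ⨆ i : S, (ν i + e i) ∂θ

/-- The probability that `i` is the (unique) maximizer of `νⱼ + εⱼ` over `j ∈ S`. -/
def choiceProb {n : ℕ} (ν : Fin n → ℝ) (S : Finset (Fin n)) (θ : Measure (Fin n → ℝ))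
    (i : Fin n) : ℝ :=
  θ.real {e | ∀ j ∈ S, j ≠ i → ν j + e j < ν i + e i}

/-- The choice data are representable by a marginal distribution model: there are admissible
marginals and deterministic utilities, the same for all assortments, such that for each assortment
`S` of the collection the observed choice probabilities are those under a joint law `θ` that
maximizes the expected maximal utility over all joint laws with these marginals. -/
def MDMRepresentable {n : ℕ} (𝒮 : Finset (Finset (Fin n)))
    (p : Fin n → Finset (Fin n) → ℝ) : Prop :=
  ∃ (F : Fin n → Measure ℝ) (ν : Fin n → ℝ), (∀ i, IsAdmissibleMarginal (F i)) ∧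
    ∀ S ∈ 𝒮, ∃ θ ∈ jointLaws F, IsMaxOn (expectedMaxUtility ν S) (jointLaws F) θ ∧
      ∀ i ∈ S, p i S = choiceProb ν S θ i

/-! ## Linear programs -/

/-- A linear constraint in real variables indexed by `V`: `ge a b` is `∑ v, a v * x v ≥ b` and
`eq a b` is `∑ v, a v * x v = b`. -/
inductive LinearConstraint (V : Type) : Type
  | ge (a : V → ℝ) (b : ℝ) : LinearConstraint V
  | eq (a : V → ℝ) (b : ℝ) : LinearConstraint V

/-- The point `x` satisfies the constraint. -/
def LinearConstraint.Holds {V : Type} [Fintype V] (x : V → ℝ) : LinearConstraint V → Prop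
  | .ge a b => b ≤ ∑ v, a v * x v
  | .eq a b => ∑ v, a v * x v = b

/-- A linear program in real variables indexed by `V`: maximize `∑ v, objective v * x v` subject
to a finite list of constraints. -/
structure LinearProgram (V : Type) where
  objective : V → ℝ
  constraints : List (LinearConstraint V)

/-- The number of variables. -/
def LinearProgram.numVariables {V : Type} [Fintype V] (_P : LinearProgram V) : ℕ :=
  Fintype.card V

/-- The number of constraints. -/
def LinearProgram.numConstraints {V : Type} (P : LinearProgram V) : ℕ :=
  P.constraints.length

/-- The point `x` is feasible. -/
def LinearProgram.IsFeasible {V : Type} [Fintype V] (P : LinearProgram V) (x : V → ℝ) : Prop :=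
  ∀ c ∈ P.constraints, c.Holds x

/-- The optimal value (`⊥` if infeasible, `⊤` if unbounded). -/
def LinearProgram.optimalValue {V : Type} [Fintype V] (P : LinearProgram V) : EReal :=
  ⨆ (x : V → ℝ) (_ : P.IsFeasible x), ((∑ v, P.objective v * x v : ℝ) : EReal)

/-! ## The linear program that checks consistency with the marginal distribution model

Its variables are indexed by `Option 𝒮`: `some S` stands for `λ(S)`, and `none` for `ε`. -/

/-- The constraint `λ(S) - λ(T) - ε ≥ 0`. -/
def gapConstraint {n : ℕ} {𝒮 : Finset (Finset (Fin n))} (S T : 𝒮) :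
    LinearConstraint (Option 𝒮) :=
  .ge (Pi.single (some S) 1 - Pi.single (some T) 1 - Pi.single none 1) 0

/-- The constraint `λ(S) - λ(T) = 0`. -/
def tieConstraint {n : ℕ} {𝒮 : Finset (Finset (Fin n))} (S T : 𝒮) :
    LinearConstraint (Option 𝒮) :=
  .eq (Pi.single (some S) 1 - Pi.single (some T) 1) 0

/-- The assortments of `𝒮` that contain product `i`, listed in non-increasing order of `p i ·`
(by merge sort). -/
def sortedAssortments {n : ℕ} (𝒮 : Finset (Finset (Fin n))) (p : Fin n → Finset (Fin n) → ℝ)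
    (i : Fin n) : List 𝒮 :=
  (Finset.univ.filter (fun S : 𝒮 => i ∈ S.1)).toList.mergeSort
    (fun S T => decide (p i T.1 ≤ p i S.1))

/-- The constraints produced by running through the rest of a sorted list, where `R` is the last
assortment seen so far with `p i R ≠ 0`. One constraint is produced for each entry `T`. -/
def chainConstraints {n : ℕ} {𝒮 : Finset (Finset (Fin n))} (p : Fin n → Finset (Fin n) → ℝ)
    (i : Fin n) : 𝒮 → List 𝒮 → List (LinearConstraint (Option 𝒮))
  | _, [] => []
  | R, T :: L =>
    if p i T.1 = 0 then gapConstraint T R :: chainConstraints p i R L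
    else (if p i T.1 = p i R.1 then tieConstraint T R else gapConstraint T R) ::
      chainConstraints p i T L

/-- The constraints that product `i` contributes, from a list of assortments containing `i`, in
non-increasing order of `p i ·`. There are none if `p i ·` vanishes on all of them. -/
def productConstraints {n : ℕ} {𝒮 : Finset (Finset (Fin n))} (p : Fin n → Finset (Fin n) → ℝ)
    (i : Fin n) : List 𝒮 → List (LinearConstraint (Option 𝒮))
  | [] => []
  | R :: L => if p i R.1 = 0 then [] else chainConstraints p i R L

/-- Maximize `ε` subject to the constraints contributed by all the products. -/
def mdmProgram {n : ℕ} (𝒮 : Finset (Finset (Fin n))) (p : Fin n → Finset (Fin n) → ℝ) :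
    LinearProgram (Option 𝒮) where
  objective := Pi.single none 1
  constraints := (List.finRange n).flatMap
    (fun i => productConstraints p i (sortedAssortments 𝒮 p i))

end

/-!
For every `l`, the maximum of `ν i + ε i` over `i ∈ S` is at most `l + ∑ i ∈ S, (ν i + ε i - l)⁺`,
with equality if exactly one of these utilities exceeds `l`; the expectation of this bound depends
only on the marginals. Choose `l` with `∑ i ∈ S, ℙ(ν i + ε i > l) = 1`. Then some joint law has
almost surely exactly one utility above `l`: mix, over `i ∈ S`, the product laws conditioned on `i`
being the only product above `l`. Hence these laws are the optimal ones, and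
`p i S = 1 - Fᵢ(l - ν i)`. The threshold `l` serves as `λ(S)`, and the order condition says that
each `Fᵢ` is increasing; conversely, a distribution function through the points
`(λ(S), 1 - p i S)` realizes given values `λ(S)` with `ν = 0`.

If some `p i S` is `1`, the threshold need not exist or be unique. It is therefore replaced by the
lower set of all `x` with `Fᵢ(x - ν i) ≤ 1 - p i S` for all `i ∈ S`: lower sets of reals form a
chain, and a finite chain embeds into `ℝ`.

In the linear program, a positive `ε` is a common lower bound for the finitely many strict
inequalities. Transitivity makes it enough to compare consecutive positive entries of each sorted
list, and its zero entries with the last positive one.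
-/

section LinearProgramming

open Filter Topology

variable {n : ℕ} {𝒮 : Finset (Finset (Fin n))} {p : Fin n → Finset (Fin n) → ℝ} {i : Fin n}
  {x : Option 𝒮 → ℝ}

/-- The order condition linking the values `lam` to the choice data. The codomain is an arbitrary
order because the values coming from a marginal distribution model are lower sets of reals. -/
def OrderCompatible {n : ℕ} {α : Type*} [Preorder α] (𝒮 : Finset (Finset (Fin n)))
    (p : Fin n → Finset (Fin n) → ℝ) (lam : 𝒮 → α) : Prop :=
  ∀ (S T : 𝒮) (i : Fin n), i ∈ S.1 → i ∈ T.1 →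
    (p i S.1 < p i T.1 → lam T < lam S) ∧ (p i S.1 = p i T.1 → p i S.1 ≠ 0 → lam S = lam T)

theorem OrderCompatible.exists_real {α : Type*} [LinearOrder α] {lam : 𝒮 → α}
    (h : OrderCompatible 𝒮 p lam) : ∃ lam' : 𝒮 → ℝ, OrderCompatible 𝒮 p lam' := by
  obtain ⟨f⟩ := Order.embedding_from_countable_to_dense (Set.range lam) ℝ
  exact ⟨fun S => f ⟨lam S, S, rfl⟩, fun S T i hS hT =>
    ⟨fun hlt => f.lt_iff_lt.2 ((h S T i hS hT).1 hlt),
      fun heq hne => congrArg f (Subtype.ext ((h S T i hS hT).2 heq hne))⟩⟩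

theorem gapConstraint_holds_iff {S T : 𝒮} :
    (gapConstraint S T).Holds x ↔ x (some T) + x none ≤ x (some S) := by
  simp only [gapConstraint, LinearConstraint.Holds, Pi.sub_apply, sub_mul, Finset.sum_sub_distrib,
    Pi.single_apply, ite_mul, one_mul, zero_mul, Finset.sum_ite_eq', Finset.mem_univ, if_true]
  rw [sub_sub, sub_nonneg]

theorem tieConstraint_holds_iff {S T : 𝒮} :
    (tieConstraint S T).Holds x ↔ x (some S) = x (some T) := by
  simp only [tieConstraint, LinearConstraint.Holds, Pi.sub_apply, sub_mul, Finset.sum_sub_distrib,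
    Pi.single_apply, ite_mul, one_mul, zero_mul, Finset.sum_ite_eq', Finset.mem_univ, if_true]
  exact sub_eq_zero

theorem mem_sortedAssortments {S : 𝒮} : S ∈ sortedAssortments 𝒮 p i ↔ i ∈ S.1 := by
  simp [sortedAssortments]

theorem pairwise_sortedAssortments (𝒮 : Finset (Finset (Fin n)))
    (p : Fin n → Finset (Fin n) → ℝ) (i : Fin n) :
    (sortedAssortments 𝒮 p i).Pairwise (fun S T => p i T.1 ≤ p i S.1) := by
  have h := List.pairwise_mergeSort (le := fun S T : 𝒮 => decide (p i T.1 ≤ p i S.1))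
    (fun _ _ _ hST hTU => by simp only [decide_eq_true_eq] at *; exact hTU.trans hST)
    (fun _ _ => by simpa using le_total _ _)
    (Finset.univ.filter (fun S : 𝒮 => i ∈ S.1)).toList
  simpa [sortedAssortments] using h

theorem length_sortedAssortments_le : (sortedAssortments 𝒮 p i).length ≤ 𝒮.card := by
  simp only [sortedAssortments, List.length_mergeSort, Finset.length_toList]
  exact (Finset.card_filter_le _ _).trans (by simp)

theorem length_chainConstraints (R : 𝒮) (L : List 𝒮) :
    (chainConstraints p i R L).length = L.length := by
  induction L generalizing R with
  | nil => rfl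
  | cons T L ih => unfold chainConstraints; split <;> simp [ih]

theorem length_productConstraints_le (L : List 𝒮) :
    (productConstraints p i L).length ≤ L.length := by
  cases L with
  | nil => simp [productConstraints]
  | cons R L =>
    rw [productConstraints]
    split_ifs
    · simp
    · simp [length_chainConstraints]

theorem numVariables_mdmProgram : (mdmProgram 𝒮 p).numVariables = 𝒮.card + 1 := by
  simp [LinearProgram.numVariables]

theorem numConstraints_mdmProgram_le : (mdmProgram 𝒮 p).numConstraints ≤ n * 𝒮.card := by
  simp only [LinearProgram.numConstraints, mdmProgram, List.length_flatMap]
  refine (List.sum_le_card_nsmul _ 𝒮.card ?_).trans (by simp)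
  simp only [List.mem_map, forall_exists_index, and_imp]
  rintro _ i - rfl
  exact (length_productConstraints_le _).trans length_sortedAssortments_le

theorem eq_gap_or_eq_tie_of_mem_chainConstraints {R : 𝒮} {L : List 𝒮}
    (hnn : ∀ T ∈ R :: L, 0 ≤ p i T.1) (hR : p i R.1 ≠ 0)
    (hs : (R :: L).Pairwise (fun S T => p i T.1 ≤ p i S.1))
    {c : LinearConstraint (Option 𝒮)} (hc : c ∈ chainConstraints p i R L) :
    ∃ S ∈ R :: L, ∃ T ∈ R :: L,
      (p i S.1 < p i T.1 ∧ c = gapConstraint S T) ∨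
        (p i S.1 = p i T.1 ∧ p i S.1 ≠ 0 ∧ c = tieConstraint S T) := by
  induction L generalizing R with
  | nil => simp [chainConstraints] at hc
  | cons T L ih =>
    simp only [List.forall_mem_cons, List.pairwise_cons] at hnn hs ih
    unfold chainConstraints at hc
    split_ifs at hc with hT hTR <;> rcases List.mem_cons.1 hc with rfl | hc
    · exact ⟨T, by simp, R, by simp, .inl ⟨hT ▸ hnn.1.lt_of_ne' hR, rfl⟩⟩
    · grind
    · exact ⟨T, by simp, R, by simp, .inr ⟨hTR, hT, rfl⟩⟩
    · grind
    · exact ⟨T, by simp, R, by simp, .inl ⟨hs.1.1.lt_of_ne hTR, rfl⟩⟩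
    · grind

theorem eq_gap_or_eq_tie_of_mem_mdmProgram (hp : ∀ S : 𝒮, ∀ i ∈ S.1, 0 ≤ p i S.1)
    {c : LinearConstraint (Option 𝒮)} (hc : c ∈ (mdmProgram 𝒮 p).constraints) :
    ∃ (S T : 𝒮) (i : Fin n), i ∈ S.1 ∧ i ∈ T.1 ∧
      ((p i S.1 < p i T.1 ∧ c = gapConstraint S T) ∨
        (p i S.1 = p i T.1 ∧ p i S.1 ≠ 0 ∧ c = tieConstraint S T)) := by
  obtain ⟨i, -, hc⟩ := List.mem_flatMap.1 hc
  have hs := pairwise_sortedAssortments 𝒮 p i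
  have hmem : ∀ S ∈ sortedAssortments 𝒮 p i, i ∈ S.1 := fun _ => mem_sortedAssortments.1
  cases hL : sortedAssortments 𝒮 p i with
  | nil => simp [hL, productConstraints] at hc
  | cons R L =>
    rw [hL] at hs hmem
    rw [hL, productConstraints] at hc
    split_ifs at hc with hR
    · simp at hc
    · obtain ⟨S, hS, T, hT, h⟩ := eq_gap_or_eq_tie_of_mem_chainConstraints
        (fun T hT => hp T i (hmem T hT)) hR hs hc
      exact ⟨S, T, i, hmem S hS, hmem T hT, h⟩

theorem isFeasible_of_gap (hp : ∀ S : 𝒮, ∀ i ∈ S.1, 0 ≤ p i S.1)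
    (hx : ∀ (S T : 𝒮) (i : Fin n), i ∈ S.1 → i ∈ T.1 →
      (p i S.1 < p i T.1 → x (some T) + x none ≤ x (some S)) ∧
      (p i S.1 = p i T.1 → p i S.1 ≠ 0 → x (some S) = x (some T))) :
    (mdmProgram 𝒮 p).IsFeasible x := by
  intro c hc
  obtain ⟨S, T, i, hS, hT, ⟨hlt, rfl⟩ | ⟨heq, hne, rfl⟩⟩ :=
    eq_gap_or_eq_tie_of_mem_mdmProgram hp hc
  · exact gapConstraint_holds_iff.2 ((hx S T i hS hT).1 hlt)
  · exact tieConstraint_holds_iff.2 ((hx S T i hS hT).2 heq hne)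

theorem forall_mem_of_chainConstraints_hold (hε : 0 < x none) {R : 𝒮} {L : List 𝒮}
    (hnn : ∀ T ∈ R :: L, 0 ≤ p i T.1) (hR : p i R.1 ≠ 0)
    (hs : (R :: L).Pairwise (fun S T => p i T.1 ≤ p i S.1))
    (hc : ∀ c ∈ chainConstraints p i R L, c.Holds x) :
    ∀ S ∈ R :: L, ∀ T ∈ R :: L, (p i S.1 < p i T.1 → x (some T) < x (some S)) ∧
      (p i S.1 = p i T.1 → p i S.1 ≠ 0 → x (some S) = x (some T)) := by
  induction L generalizing R with
  | nil => simp
  | cons T L ih =>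
    simp only [List.forall_mem_cons, List.pairwise_cons] at hnn hs ih ⊢
    unfold chainConstraints at hc
    split_ifs at hc with hT hTR <;>
      simp only [List.forall_mem_cons, gapConstraint_holds_iff, tieConstraint_holds_iff] at hc
    · have := ih ⟨hnn.1, hnn.2.2⟩ hR ⟨hs.1.2, hs.2.2⟩ hc.2
      grind
    · have := ih hnn.2 hT hs.2 hc.2
      grind
    · have := ih hnn.2 hT hs.2 hc.2
      grind

theorem orderCompatible_of_isFeasible (hp : ∀ S : 𝒮, ∀ i ∈ S.1, 0 ≤ p i S.1)
    (hx : (mdmProgram 𝒮 p).IsFeasible x) (hε : 0 < x none) :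
    OrderCompatible 𝒮 p (fun S => x (some S)) := by
  intro S T i hS hT
  have hc : ∀ c ∈ productConstraints p i (sortedAssortments 𝒮 p i), c.Holds x := fun c hc =>
    hx c (List.mem_flatMap.2 ⟨i, List.mem_finRange i, hc⟩)
  have hs := pairwise_sortedAssortments 𝒮 p i
  have hnn : ∀ U ∈ sortedAssortments 𝒮 p i, 0 ≤ p i U.1 := fun U hU =>
    hp U i (mem_sortedAssortments.1 hU)
  replace hS := mem_sortedAssortments (p := p).2 hS
  replace hT := mem_sortedAssortments (p := p).2 hT
  cases hL : sortedAssortments 𝒮 p i with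
  | nil => simp [hL] at hS
  | cons R L =>
    rw [hL] at hc hs hnn hS hT
    rw [productConstraints] at hc
    split_ifs at hc with hR
    · have hzero : ∀ U ∈ R :: L, p i U.1 = 0 := by
        intro U hU
        refine le_antisymm ?_ (hnn U hU)
        rcases List.mem_cons.1 hU with rfl | hU'
        exacts [hR.le, hR ▸ (List.pairwise_cons.1 hs).1 U hU']
      simp [hzero S hS, hzero T hT]
    · exact forall_mem_of_chainConstraints_hold hε hnn hR hs hc S hS T hT

theorem exists_pos_forall_lt_imp_add_le {α : Type*} [Finite α] (f : α → ℝ) :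
    ∃ ε > 0, ∀ a b, f a < f b → f a + ε ≤ f b := by
  have h : ∀ᶠ ε in 𝓝[>] (0 : ℝ), ∀ a b, f a < f b → f a + ε ≤ f b := by
    simp only [eventually_all]
    intro a b hab
    filter_upwards [Ioc_mem_nhdsGT (sub_pos.2 hab)] with ε hε using by linarith [hε.2]
  obtain ⟨ε, hε, hpos⟩ := (h.and self_mem_nhdsWithin).exists
  exact ⟨ε, hpos, hε⟩

theorem optimalValue_mdmProgram_pos_iff :
    0 < (mdmProgram 𝒮 p).optimalValue ↔ ∃ x, (mdmProgram 𝒮 p).IsFeasible x ∧ 0 < x none := by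
  have hobj : ∀ x : Option 𝒮 → ℝ, ∑ v, (mdmProgram 𝒮 p).objective v * x v = x none := fun x => by
    simp [mdmProgram, Pi.single_apply]
  simp only [LinearProgram.optimalValue, lt_iSup_iff, hobj, EReal.coe_pos, exists_prop]

theorem exists_orderCompatible_iff_optimalValue_pos (hp : ∀ S : 𝒮, ∀ i ∈ S.1, 0 ≤ p i S.1) :
    (∃ lam : 𝒮 → ℝ, OrderCompatible 𝒮 p lam) ↔ 0 < (mdmProgram 𝒮 p).optimalValue := by
  rw [optimalValue_mdmProgram_pos_iff]
  constructor
  · rintro ⟨lam, h⟩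
    obtain ⟨ε, hε, hgap⟩ := exists_pos_forall_lt_imp_add_le lam
    exact ⟨fun v => v.elim ε lam, isFeasible_of_gap hp fun S T i hS hT =>
      ⟨fun hlt => hgap T S ((h S T i hS hT).1 hlt), (h S T i hS hT).2⟩, hε⟩
  · rintro ⟨x, hx, hε⟩
    exact ⟨_, orderCompatible_of_isFeasible hp hx hε⟩

end LinearProgramming

section Cdf

variable {μ : Measure ℝ} [IsProbabilityMeasure μ] {x y : ℝ}

theorem cdf_lt_cdf_iff : cdf μ x < cdf μ y ↔ 0 < μ (Set.Ioc x y) := by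
  rw [← sub_pos, ← ENNReal.ofReal_pos, ← StieltjesFunction.measure_Ioc, measure_cdf]

theorem measure_Ioi_eq_ofReal_one_sub_cdf (μ : Measure ℝ) [IsProbabilityMeasure μ] (x : ℝ) :
    μ (Set.Ioi x) = ENNReal.ofReal (1 - cdf μ x) := by
  rw [cdf_eq_real, ← probReal_compl_eq_one_sub measurableSet_Iic, Set.compl_Iic,
    ofReal_measureReal]

theorem continuous_cdf (μ : Measure ℝ) [IsProbabilityMeasure μ] [NullSingletonClass μ] :
    Continuous (cdf μ) := by
  refine continuous_iff_continuousAt.2 fun x => ?_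
  rw [(monotone_cdf μ).continuousAt_iff_leftLim_eq_rightLim, (cdf μ).rightLim_eq]
  refine ((monotone_cdf μ).leftLim_le le_rfl).antisymm (sub_nonpos.1 ?_)
  rw [← ENNReal.ofReal_eq_zero, ← StieltjesFunction.measure_singleton, measure_cdf,
    measure_singleton]

theorem exists_mem_support_le_of_cdf_pos (hx : 0 < cdf μ x) :
    ∃ a ∈ μ.support, a ≤ x ∧ cdf μ x ≤ cdf μ a := by
  have hpos : 0 < μ (Set.Iic x) := by rwa [← ofReal_cdf, ENNReal.ofReal_pos]
  have hclosed : IsClosed (Set.Iic x ∩ μ.support) := isClosed_Iic.inter Measure.isClosed_support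
  have hmax := hclosed.isGreatest_csSup (Measure.nonempty_inter_support_of_pos hpos)
    ⟨x, fun z hz => hz.1⟩
  refine ⟨_, hmax.1.2, hmax.1.1, not_lt.1 fun hlt => ?_⟩
  obtain ⟨z, hz, hzs⟩ := Measure.nonempty_inter_support_of_pos (cdf_lt_cdf_iff.1 hlt)
  exact (hmax.2 ⟨hz.2, hzs⟩).not_gt hz.1

theorem exists_mem_support_ge_of_cdf_lt_one [NullSingletonClass μ] (hy : cdf μ y < 1) :
    ∃ b ∈ μ.support, y ≤ b ∧ cdf μ b ≤ cdf μ y := by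
  have hpos : 0 < μ (Set.Ici y) := by
    rwa [← Ioi_ae_eq_Ici.measure_eq, measure_Ioi_eq_ofReal_one_sub_cdf, ENNReal.ofReal_pos, sub_pos]
  have hclosed : IsClosed (Set.Ici y ∩ μ.support) := isClosed_Ici.inter Measure.isClosed_support
  have hmin := hclosed.isLeast_csInf (Measure.nonempty_inter_support_of_pos hpos)
    ⟨y, fun z hz => hz.1⟩
  refine ⟨_, hmin.1.2, hmin.1.1, not_lt.1 fun hlt => ?_⟩
  rw [cdf_lt_cdf_iff, ← Ioo_ae_eq_Ioc.measure_eq] at hlt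
  obtain ⟨z, hz, hzs⟩ := Measure.nonempty_inter_support_of_pos hlt
  exact (hmin.2 ⟨hz.1.le, hzs⟩).not_gt hz.2

theorem IsAdmissibleMarginal.nullSingletonClass {μ : Measure ℝ} (h : IsAdmissibleMarginal μ) :
    NullSingletonClass μ :=
  ⟨fun x => h.absolutelyContinuous (measure_singleton x)⟩

theorem IsAdmissibleMarginal.cdf_lt_cdf {μ : Measure ℝ} (h : IsAdmissibleMarginal μ) {x y : ℝ}
    (hxy : x < y) (h0 : 0 < cdf μ x) (h1 : cdf μ x < 1) : cdf μ x < cdf μ y := by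
  have := h.isProbabilityMeasure
  have := h.nullSingletonClass
  rcases (cdf_le_one μ y).lt_or_eq with hy | hy
  · obtain ⟨a, ha, hax, hxa⟩ := exists_mem_support_le_of_cdf_pos h0
    obtain ⟨b, hb, hyb, hby⟩ := exists_mem_support_ge_of_cdf_lt_one hy
    calc cdf μ x ≤ cdf μ a := hxa
      _ < cdf μ b := h.strictMonoOn_cdf ha hb (hax.trans_lt (hxy.trans_le hyb))
      _ ≤ cdf μ y := hby
  · exact hy ▸ h1

end Cdf

section Interpolation

open Set

variable {μ μ' : Measure ℝ} {a b c x : ℝ}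

/-- The measure `μ` lives on `[a, b]`, is absolutely continuous, and charges every subinterval.
Normalized measures of this kind are admissible marginals, and they can be built by adding measures
on adjacent intervals. -/
structure IsSpreadOnIcc (μ : Measure ℝ) (a b : ℝ) : Prop where
  absolutelyContinuous : μ ≪ volume
  measure_compl_Icc : μ (Icc a b)ᶜ = 0
  measure_Ioo_pos : ∀ x y, a ≤ x → x < y → y ≤ b → 0 < μ (Ioo x y)

theorem isSpreadOnIcc_smul_restrict {r : ENNReal} (hr : r ≠ 0) (a b : ℝ) :
    IsSpreadOnIcc (r • volume.restrict (Icc a b)) a b where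
  absolutelyContinuous :=
    (Measure.absolutelyContinuous_of_le Measure.restrict_le_self).smul_left _
  measure_compl_Icc := by
    rw [Measure.smul_apply, Measure.restrict_apply measurableSet_Icc.compl, compl_inter_self,
      measure_empty, smul_zero]
  measure_Ioo_pos x y hax hxy hyb := by
    rw [Measure.smul_apply, Measure.restrict_apply measurableSet_Ioo,
      inter_eq_left.2 (Ioo_subset_Icc_self.trans (Icc_subset_Icc hax hyb)), Real.volume_Ioo]
    exact ENNReal.mul_pos hr (ENNReal.ofReal_pos.2 (sub_pos.2 hxy)).ne'

namespace IsSpreadOnIcc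

theorem add (hμ : IsSpreadOnIcc μ a b) (hμ' : IsSpreadOnIcc μ' b c) (hab : a ≤ b) (hbc : b ≤ c) :
    IsSpreadOnIcc (μ + μ') a c where
  absolutelyContinuous := hμ.absolutelyContinuous.add_left hμ'.absolutelyContinuous
  measure_compl_Icc := by
    rw [Measure.add_apply, add_eq_zero]
    exact ⟨measure_mono_null (compl_subset_compl.2 (Icc_subset_Icc_right hbc))
      hμ.measure_compl_Icc, measure_mono_null (compl_subset_compl.2 (Icc_subset_Icc_left hab))
      hμ'.measure_compl_Icc⟩
  measure_Ioo_pos x y hax hxy hyc := by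
    rw [Measure.add_apply]
    rcases lt_or_ge x b with hxb | hbx
    · refine (hμ.measure_Ioo_pos x (min y b) hax (lt_min hxy hxb) (min_le_right _ _)).trans_le ?_
      exact (measure_mono (Ioo_subset_Ioo_right (min_le_left _ _))).trans le_self_add
    · exact (hμ'.measure_Ioo_pos x y hbx hxy hyc).trans_le le_add_self

theorem measure_Iic_of_le (h : IsSpreadOnIcc μ a b) (hx : x ≤ a) : μ (Iic x) = 0 := by
  refine measure_mono_null (t := (Icc a b)ᶜ ∪ {a}) (fun z hz => ?_)
    (measure_union_null h.measure_compl_Icc (h.absolutelyContinuous (measure_singleton a)))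
  exact (le_trans hz hx).lt_or_eq.imp (fun hza hz => hza.not_ge hz.1) id

theorem measure_Iic_of_ge (h : IsSpreadOnIcc μ a b) (hx : b ≤ x) : μ (Iic x) = μ univ :=
  measure_congr (ae_eq_univ.2 (measure_mono_null
    (compl_subset_compl.2 fun _ hz => hz.2.trans hx) h.measure_compl_Icc))

theorem isAdmissibleMarginal [IsProbabilityMeasure μ] (h : IsSpreadOnIcc μ a b) :
    IsAdmissibleMarginal μ := by
  have hmem : ∀ᵐ x ∂μ, x ∈ Icc a b := h.measure_compl_Icc
  have hsupp : μ.support ⊆ Icc a b := Measure.support_subset_of_isClosed isClosed_Icc hmem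
  refine ⟨inferInstance, h.absolutelyContinuous, fun x hx y hy hxy => ?_, ?_⟩
  · exact cdf_lt_cdf_iff.2 ((h.measure_Ioo_pos x y (hsupp hx).1 hxy (hsupp hy).2).trans_le
      (measure_mono Ioo_subset_Ioc_self))
  · refine Integrable.of_bound (by fun_prop) (max |a| |b|) ?_
    filter_upwards [hmem] with x hx using abs_le_max_abs_abs hx.1 hx.2

end IsSpreadOnIcc

theorem exists_isSpreadOnIcc_measure_Iic_eq {s : Finset (ℝ × ℝ)} (hs : s.Nonempty)
    (h0 : ∀ u ∈ s, 0 ≤ u.2) (hmono : ∀ u ∈ s, ∀ v ∈ s, u.1 < v.1 ↔ u.2 < v.2) :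
    ∃ (μ : Measure ℝ) (a : ℝ), ∃ b ∈ s, (∀ u ∈ s, u.1 ≤ b.1) ∧ a ≤ b.1 ∧
      IsSpreadOnIcc μ a b.1 ∧ ∀ u ∈ s, μ (Iic u.1) = ENNReal.ofReal u.2 := by
  induction s using Finset.induction_on_max_value (fun u : ℝ × ℝ => u.1) with
  | empty => exact absurd hs Finset.not_nonempty_empty
  | insert m s hms hmax ih =>
    simp only [Finset.forall_mem_insert] at h0 hmono
    rcases s.eq_empty_or_nonempty with rfl | hne
    · have hspread := isSpreadOnIcc_smul_restrict one_ne_zero (m.1 - m.2) m.1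
      rw [one_smul] at hspread
      refine ⟨_, _, m, by simp, by simp, by linarith [h0.1], hspread, fun u hu => ?_⟩
      obtain rfl : u = m := by simpa using hu
      rw [hspread.measure_Iic_of_ge le_rfl, Measure.restrict_apply_univ, Real.volume_Icc,
        sub_sub_cancel]
    · obtain ⟨μ, a, b, hb, hbmax, hab, hspread, hμ⟩ := ih hne h0.2 fun u hu => (hmono.2 u hu).2
      have hbm : b.1 < m.1 := (hmax b hb).lt_of_ne fun heq => hms <| by
        have h2 : b.2 = m.2 := le_antisymm (not_lt.1 fun h => ((hmono.1.2 b hb).2 h).ne' heq)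
          (not_lt.1 fun h => ((hmono.2 b hb).1.2 h).ne heq)
        exact Prod.ext heq h2 ▸ hb
      have hbm2 : b.2 < m.2 := (hmono.2 b hb).1.1 hbm
      have hslope : 0 < (m.2 - b.2) / (m.1 - b.1) := div_pos (sub_pos.2 hbm2) (sub_pos.2 hbm)
      have hslab := isSpreadOnIcc_smul_restrict (ENNReal.ofReal_pos.2 hslope).ne' b.1 m.1
      have hsum := hspread.add hslab hab hbm.le
      refine ⟨_, a, m, by simp, by simpa using hmax, hab.trans hbm.le, hsum, ?_⟩
      refine (Finset.forall_mem_insert _ _ _).2 ⟨?_, fun u hu => ?_⟩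
      · rw [hsum.measure_Iic_of_ge le_rfl, Measure.add_apply,
          ← hspread.measure_Iic_of_ge le_rfl, hμ b hb, Measure.smul_apply,
          Measure.restrict_apply_univ, Real.volume_Icc, smul_eq_mul,
          ← ENNReal.ofReal_mul hslope.le, div_mul_cancel₀ _ (sub_pos.2 hbm).ne',
          ← ENNReal.ofReal_add (h0.2 b hb) (sub_pos.2 hbm2).le, add_sub_cancel]
      · rw [Measure.add_apply, hslab.measure_Iic_of_le (hbmax u hu), add_zero, hμ u hu]

theorem exists_between_of_lt_one_of_eq_one {ι : Type*} [Finite ι] {x q : ι → ℝ}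
    (hlt : ∀ i j, q i < q j → x i < x j) :
    ∃ t, (∀ i, q i < 1 → x i < t) ∧ ∀ j, q j = 1 → t < x j := by
  classical
  cases nonempty_fintype ι
  obtain ⟨t, htlt, hltt⟩ := Order.exists_between_finsets
    (({i | q i < 1} : Finset ι).image x) (({i | q i = 1} : Finset ι).image x) (by
      simp only [Finset.mem_image, Finset.mem_filter_univ]
      rintro _ ⟨i, hi, rfl⟩ _ ⟨j, hj, rfl⟩
      exact hlt i j (hj ▸ hi))
  simp only [Finset.forall_mem_image, Finset.mem_filter_univ] at htlt hltt
  exact ⟨t, @htlt, @hltt⟩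

theorem exists_isAdmissibleMarginal_cdf_eq {ι : Type*} [Finite ι] {x q : ι → ℝ}
    (h0 : ∀ i, 0 ≤ q i) (h1 : ∀ i, q i ≤ 1) (hlt : ∀ i j, q i < q j → x i < x j)
    (heq : ∀ i j, q i = q j → q i ≠ 1 → x i = x j) :
    ∃ μ, IsAdmissibleMarginal μ ∧ ∀ i, cdf μ (x i) = q i := by
  classical
  cases nonempty_fintype ι
  obtain ⟨t, htlt, hltt⟩ := exists_between_of_lt_one_of_eq_one hlt
  let s : Finset (ℝ × ℝ) := insert (t, 1) (({i | q i < 1} : Finset ι).image fun i => (x i, q i))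
  have hlt_iff : ∀ i j, q i < 1 → q j < 1 → (x i < x j ↔ q i < q j) := by
    refine fun i j _ hj => ⟨fun h => not_le.1 fun hji => ?_, hlt i j⟩
    rcases hji.lt_or_eq with hji | hji
    exacts [h.not_gt (hlt j i hji), h.ne' (heq j i hji hj.ne)]
  have hmono : ∀ u ∈ s, ∀ v ∈ s, u.1 < v.1 ↔ u.2 < v.2 := by
    simp only [s, Finset.forall_mem_insert, Finset.forall_mem_image, Finset.mem_filter_univ]
    grind
  obtain ⟨μ, a, b, hb, hbmax, -, hspread, hμ⟩ :=
    exists_isSpreadOnIcc_measure_Iic_eq (s := s) ⟨_, Finset.mem_insert_self _ _⟩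
      (by simp [s, h0]) hmono
  have hbt : b.1 ≤ t := by
    simp only [s, Finset.mem_insert, Finset.mem_image, Finset.mem_filter_univ] at hb
    obtain rfl | ⟨i, hi, rfl⟩ := hb
    exacts [le_rfl, (htlt i hi).le]
  have hone : ∀ y, t ≤ y → μ (Iic y) = 1 := fun y hy => by
    rw [hspread.measure_Iic_of_ge (hbt.trans hy), ← hspread.measure_Iic_of_ge hbt,
      hμ (t, 1) (Finset.mem_insert_self _ _), ENNReal.ofReal_one]
  have : IsProbabilityMeasure μ := ⟨by rw [← hspread.measure_Iic_of_ge hbt, hone t le_rfl]⟩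
  refine ⟨μ, hspread.isAdmissibleMarginal, fun i => ?_⟩
  rw [cdf_eq_real, measureReal_def]
  rcases (h1 i).lt_or_eq with hi | hi
  · have hmem : (x i, q i) ∈ s :=
      Finset.mem_insert_of_mem (Finset.mem_image_of_mem _ (by simpa using hi))
    rw [hμ _ hmem, ENNReal.toReal_ofReal (h0 i)]
  · rw [hone _ (hltt i hi).le, hi, ENNReal.toReal_one]

end Interpolation

section Coupling

variable {ι : Type*} [Fintype ι] {Ω : ι → Type*} [∀ i, MeasurableSpace (Ω i)]
  {μ : ∀ i, Measure (Ω i)} {A : ∀ i, Set (Ω i)}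

section DecidableEq

variable [DecidableEq ι]

/-- The law `μ j` of coordinate `j` conditioned on the event that, among the events `A`, the
`i`-th one occurs and no other does. When the probabilities of these events sum to one, the mixture
over `i` of the products of these laws has marginals `μ`. -/
noncomputable def conditionedMarginal (μ : ∀ i, Measure (Ω i)) (A : ∀ i, Set (Ω i)) (i j : ι) :
    Measure (Ω j) :=
  (μ j)[|if j = i then A j else (A j)ᶜ]

theorem ae_existsUnique_mem_pi_conditionedMarginal (hA : ∀ i, MeasurableSet (A i)) {i : ι}
    [∀ j, IsProbabilityMeasure (conditionedMarginal μ A i j)] :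
    ∀ᵐ e ∂Measure.pi (conditionedMarginal μ A i), ∃! j, e j ∈ A j := by
  have hmem : ∀ j, ∀ᵐ e ∂Measure.pi (conditionedMarginal μ A i),
      e j ∈ if j = i then A j else (A j)ᶜ := fun j =>
    (Measure.tendsto_eval_ae_ae (μ := conditionedMarginal μ A i) (i := j)).eventually
      (ae_cond_mem (by split_ifs; exacts [hA j, (hA j).compl]))
  filter_upwards [ae_all_iff.2 hmem] with e he
  refine ⟨i, by simpa using he i, fun j hj => ?_⟩
  by_contra hji
  exact (show e j ∈ (A j)ᶜ by simpa only [if_neg hji] using he j) hj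

variable [∀ i, IsProbabilityMeasure (μ i)]

theorem sum_erase_measure_eq_measure_compl (hsum : ∑ i, μ i (A i) = 1) {j : ι}
    (hA : MeasurableSet (A j)) :
    ∑ i ∈ Finset.univ.erase j, μ i (A i) = μ j (A j)ᶜ := by
  rw [← Finset.add_sum_erase _ _ (Finset.mem_univ j),
    ← prob_add_prob_compl (μ := μ j) hA] at hsum
  exact (ENNReal.add_right_inj (measure_ne_top _ _)).1 hsum

theorem isProbabilityMeasure_conditionedMarginal (hsum : ∑ i, μ i (A i) = 1) {i j : ι}
    (hi : μ i (A i) ≠ 0) (hA : MeasurableSet (A j)) :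
    IsProbabilityMeasure (conditionedMarginal μ A i j) := by
  rw [conditionedMarginal]
  split_ifs with hji
  · exact cond_isProbabilityMeasure (hji ▸ hi)
  · refine cond_isProbabilityMeasure (ne_of_gt ?_)
    calc 0 < μ i (A i) := hi.bot_lt
      _ ≤ ∑ k ∈ Finset.univ.erase j, μ k (A k) :=
        Finset.single_le_sum_of_canonicallyOrdered (f := fun k => μ k (A k))
          (Finset.mem_erase.2 ⟨Ne.symm hji, Finset.mem_univ i⟩)
      _ = μ j (A j)ᶜ := sum_erase_measure_eq_measure_compl hsum hA

theorem sum_mul_conditionedMarginal (hsum : ∑ i, μ i (A i) = 1) {j : ι}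
    (hA : MeasurableSet (A j)) (s : Set (Ω j)) :
    ∑ i, μ i (A i) * conditionedMarginal μ A i j s = μ j s := by
  have hother : ∀ i ∈ Finset.univ.erase j,
      μ i (A i) * conditionedMarginal μ A i j s = μ i (A i) * (μ j)[|(A j)ᶜ] s := fun i hi => by
    rw [conditionedMarginal, if_neg (Finset.ne_of_mem_erase hi).symm]
  rw [← Finset.add_sum_erase _ _ (Finset.mem_univ j), Finset.sum_congr rfl hother,
    ← Finset.sum_mul, sum_erase_measure_eq_measure_compl hsum hA, conditionedMarginal,
    if_pos rfl, mul_comm, mul_comm (μ j (A j)ᶜ), cond_add_cond_compl_eq hA]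

end DecidableEq

theorem exists_map_eval_eq_and_ae_existsUnique_mem [∀ i, IsProbabilityMeasure (μ i)]
    (hA : ∀ i, MeasurableSet (A i)) (hsum : ∑ i, μ i (A i) = 1) :
    ∃ θ : Measure (∀ i, Ω i), IsProbabilityMeasure θ ∧
      (∀ i, θ.map (fun e => e i) = μ i) ∧ ∀ᵐ e ∂θ, ∃! i, e i ∈ A i := by
  classical
  let θ : Measure (∀ i, Ω i) := ∑ i, μ i (A i) • Measure.pi (conditionedMarginal μ A i)
  have hθ : ∀ s, θ s = ∑ i, μ i (A i) * Measure.pi (conditionedMarginal μ A i) s := fun s => by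
    simp [θ, Measure.finsetSum_apply]
  have hcongr : ∀ {f g : ι → ENNReal}, (∀ i, (∀ j, IsProbabilityMeasure
      (conditionedMarginal μ A i j)) → f i = g i) →
      ∑ i, μ i (A i) * f i = ∑ i, μ i (A i) * g i := fun {f g} hfg => by
    refine Finset.sum_congr rfl fun i _ => ?_
    rcases eq_or_ne (μ i (A i)) 0 with h0 | h0
    · rw [h0, zero_mul, zero_mul]
    · rw [hfg i fun j => isProbabilityMeasure_conditionedMarginal hsum h0 (hA j)]
  refine ⟨θ, ⟨?_⟩, fun j => ?_, ?_⟩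
  · rw [hθ, hcongr (g := fun _ => 1) fun i _ => measure_univ]
    simp only [mul_one, hsum]
  · ext s hs
    rw [Measure.map_apply (measurable_pi_apply j) hs, hθ, ← sum_mul_conditionedMarginal hsum (hA j)]
    exact hcongr fun i _ => (measurePreserving_eval (conditionedMarginal μ A i) j).measure_preimage
      hs.nullMeasurableSet
  · rw [ae_iff, hθ, hcongr (g := fun _ => 0) fun i _ =>
      ae_iff.1 (ae_existsUnique_mem_pi_conditionedMarginal hA)]
    simp only [mul_zero, Finset.sum_const_zero]

end Coupling

section Excess

variable {ι : Type*} {S : Finset ι} {l : ℝ} {u : ι → ℝ}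

/-- The upper bound `l + ∑ i ∈ S, (u i - l)⁺` for the maximum of `u` over `S`. Being a sum of
functions of one coordinate each, it has the same expectation under all joint laws with given
marginals. -/
noncomputable def excessBound (S : Finset ι) (l : ℝ) (u : ι → ℝ) : ℝ :=
  l + ∑ i ∈ S, max (u i - l) 0

theorem iSup_le_excessBound (hS : S.Nonempty) : ⨆ i : S, u i ≤ excessBound S l u := by
  have := hS.to_subtype
  refine ciSup_le fun i => ?_
  calc u i = l + (u i - l) := (add_sub_cancel _ _).symm
    _ ≤ l + ∑ j ∈ S, max (u j - l) 0 := by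
      gcongr
      exact (le_max_left _ 0).trans (Finset.single_le_sum (f := fun j => max (u j - l) 0)
        (fun _ _ => le_max_right _ _) i.2)

theorem iSup_eq_excessBound (h : ∃! i, i ∈ S ∧ l < u i) : ⨆ i : S, u i = excessBound S l u := by
  obtain ⟨i, ⟨hi, hlt⟩, huniq⟩ := h
  have hsum : ∑ j ∈ S, max (u j - l) 0 = max (u i - l) 0 :=
    Finset.sum_eq_single_of_mem i hi fun j hj hji =>
      max_eq_right (sub_nonpos.2 (not_lt.1 fun h => hji (huniq j ⟨hj, h⟩)))
  refine (iSup_le_excessBound ⟨i, hi⟩).antisymm ?_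
  rw [excessBound, hsum, max_eq_left (sub_pos.2 hlt).le, add_sub_cancel]
  exact le_ciSup (f := fun i : S => u i) (Set.finite_range _).bddAbove ⟨i, hi⟩

theorem eq_of_iSup_eq_excessBound (h : ⨆ i : S, u i = excessBound S l u) {i j : ι} (hi : i ∈ S)
    (hj : j ∈ S) (hli : l < u i) (hlj : l < u j) : i = j := by
  classical
  have : Nonempty S := ⟨⟨i, hi⟩⟩
  obtain ⟨k, hk⟩ := exists_eq_ciSup_of_finite (f := fun i : S => u i)
  suffices honly : ∀ m ∈ S, l < u m → m = k by rw [honly i hi hli, honly j hj hlj]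
  intro m hm hlm
  by_contra hmk
  have hpair : ∑ i ∈ {m, k.1}, max (u i - l) 0 ≤ ∑ i ∈ S, max (u i - l) 0 :=
    Finset.sum_le_sum_of_subset_of_nonneg (by simp [Finset.insert_subset_iff, hm])
      fun _ _ _ => le_max_right _ _
  rw [Finset.sum_pair hmk] at hpair
  rw [← hk, excessBound] at h
  linarith [le_max_left (u k - l) 0, le_max_left (u m - l) 0]

theorem forall_lt_iff_of_existsUnique_lt (h : ∃! i, i ∈ S ∧ l < u i) {i : ι} (hi : i ∈ S) :
    (∀ j ∈ S, j ≠ i → u j < u i) ↔ l < u i := by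
  obtain ⟨k, ⟨hk, hlt⟩, huniq⟩ := h
  constructor
  · intro hmax
    rcases eq_or_ne k i with rfl | hki
    exacts [hlt, hlt.trans (hmax k hk hki)]
  · intro hli j hj hji
    obtain rfl := huniq i ⟨hi, hli⟩
    exact (not_lt.1 fun hlj => hji (huniq j ⟨hj, hlj⟩)).trans_lt hli

end Excess

theorem ae_existsUnique_mem_of_sum_measure_eq_one {α ι : Type*} [MeasurableSpace α]
    {θ : Measure α} [IsProbabilityMeasure θ] {S : Finset ι} {A : ι → Set α}
    (hA : ∀ i ∈ S, MeasurableSet (A i)) (hsum : ∑ i ∈ S, θ (A i) = 1)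
    (hdisj : ∀ᵐ e ∂θ, ∀ i ∈ S, ∀ j ∈ S, e ∈ A i → e ∈ A j → i = j) :
    ∀ᵐ e ∂θ, ∃! i, i ∈ S ∧ e ∈ A i := by
  have hpair : (S : Set ι).Pairwise (Function.onFun (AEDisjoint θ) A) := fun i hi j hj hij =>
    measure_eq_zero_iff_ae_notMem.2 (hdisj.mono fun e he hmem =>
      hij (he i hi j hj hmem.1 hmem.2))
  have hunion : ∀ᵐ e ∂θ, e ∈ ⋃ i ∈ S, A i := by
    refine (mem_ae_iff_prob_eq_one (S.measurableSet_biUnion hA)).2 ?_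
    rw [measure_biUnion_finset₀ hpair fun i hi => (hA i hi).nullMeasurableSet, hsum]
  filter_upwards [hdisj, hunion] with e he hmem
  obtain ⟨i, hi, hei⟩ := Set.mem_iUnion₂.1 hmem
  exact ⟨i, ⟨hi, hei⟩, fun j hj => he j hj.1 i hi hj.2 hei⟩

section Duality

variable {n : ℕ} {F : Fin n → Measure ℝ} {ν : Fin n → ℝ} {S : Finset (Fin n)} {l : ℝ}
  {θ : Measure (Fin n → ℝ)} {i : Fin n}

theorem measure_setOf_lt_add (μ : Measure ℝ) [IsProbabilityMeasure μ] (l c : ℝ) :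
    μ {x | l < c + x} = ENNReal.ofReal (1 - cdf μ (l - c)) := by
  rw [← measure_Ioi_eq_ofReal_one_sub_cdf]
  congr 1
  ext x
  exact (sub_lt_iff_lt_add' (a := l) (b := c) (c := x)).symm

theorem sum_measure_setOf_lt_add_eq_one [∀ i, IsProbabilityMeasure (F i)]
    (hsum : ∑ i ∈ S, (1 - cdf (F i) (l - ν i)) = 1) : ∑ i ∈ S, F i {x | l < ν i + x} = 1 := by
  simp only [measure_setOf_lt_add]
  rw [← ENNReal.ofReal_sum_of_nonneg fun i _ => sub_nonneg.2 (cdf_le_one _ _), hsum,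
    ENNReal.ofReal_one]

theorem measure_eval_mem_of_mem_jointLaws (hθ : θ ∈ jointLaws F) {s : Set ℝ}
    (hs : MeasurableSet s) : θ {e | e i ∈ s} = F i s := by
  rw [← hθ.2 i, Measure.map_apply (measurable_pi_apply i) hs, Set.preimage]

theorem measurableSet_setOf_lt_add (l c : ℝ) : MeasurableSet {x : ℝ | l < c + x} :=
  measurableSet_lt measurable_const (measurable_const_add c)

theorem choiceProb_eq_one_sub_cdf [IsProbabilityMeasure (F i)] (hθ : θ ∈ jointLaws F)
    (hu : ∀ᵐ e ∂θ, ∃! i, i ∈ S ∧ l < ν i + e i) (hi : i ∈ S) :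
    choiceProb ν S θ i = 1 - cdf (F i) (l - ν i) := by
  have hae : {e : Fin n → ℝ | ∀ j ∈ S, j ≠ i → ν j + e j < ν i + e i} =ᵐ[θ]
      {e | e i ∈ {x | l < ν i + x}} :=
    Filter.eventuallyEq_set.2 (hu.mono fun e he => forall_lt_iff_of_existsUnique_lt he hi)
  rw [choiceProb, measureReal_congr hae, measureReal_def,
    measure_eval_mem_of_mem_jointLaws hθ (measurableSet_setOf_lt_add l _), measure_setOf_lt_add,
    ENNReal.toReal_ofReal (sub_nonneg.2 (cdf_le_one _ _))]

theorem integrable_utility (hF : Integrable (fun x : ℝ => x) (F i)) (hθ : θ ∈ jointLaws F) :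
    Integrable (fun e => ν i + e i) θ := by
  have := hθ.1
  rw [← hθ.2 i] at hF
  exact (integrable_const _).add (hF.comp_measurable (measurable_pi_apply i))

theorem integrable_max_utility_sub (hF : Integrable (fun x : ℝ => x) (F i))
    (hθ : θ ∈ jointLaws F) : Integrable (fun e => max (ν i + e i - l) 0) θ := by
  have := hθ.1
  exact ((integrable_utility hF hθ).sub (integrable_const l)).pos_part

theorem integrable_excessBound (hF : ∀ i, Integrable (fun x : ℝ => x) (F i))
    (hθ : θ ∈ jointLaws F) : Integrable (fun e => excessBound S l fun i => ν i + e i) θ := by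
  have := hθ.1
  exact (integrable_const l).add (integrable_finsetSum _ fun i _ =>
    integrable_max_utility_sub (hF i) hθ)

theorem integrable_iSup_utility (hF : ∀ i, Integrable (fun x : ℝ => x) (F i))
    (hθ : θ ∈ jointLaws F) (hS : S.Nonempty) :
    Integrable (fun e => ⨆ i : S, (ν i + e i)) θ := by
  have := hS.to_subtype
  refine (integrable_finsetSum S fun i _ => (integrable_utility (ν := ν) (hF i) hθ).abs).mono'
    (Measurable.iSup fun i : S => by fun_prop).aestronglyMeasurable (ae_of_all _ fun e => ?_)
  obtain ⟨k, hk⟩ := exists_eq_ciSup_of_finite (f := fun i : S => ν i + e i)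
  rw [← hk]
  exact Finset.single_le_sum (f := fun i => |ν i + e i|) (fun _ _ => abs_nonneg _) k.2

/-- The common expectation of the excess bound under all joint laws with marginals `F`; minimizing
it over `l` is the dual of maximizing the expected maximal utility. -/
noncomputable def dualValue (F : Fin n → Measure ℝ) (ν : Fin n → ℝ) (S : Finset (Fin n)) (l : ℝ) :
    ℝ :=
  l + ∑ i ∈ S, ∫ x, max (ν i + x - l) 0 ∂F i

theorem integral_excessBound (hF : ∀ i, Integrable (fun x : ℝ => x) (F i))
    (hθ : θ ∈ jointLaws F) :
    ∫ e, excessBound S l (fun i => ν i + e i) ∂θ = dualValue F ν S l := by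
  have := hθ.1
  have hint : ∀ i ∈ S, Integrable (fun e : Fin n → ℝ => max (ν i + e i - l) 0) θ := fun i _ =>
    integrable_max_utility_sub (hF i) hθ
  have hmarginal : ∀ i, ∫ e, max (ν i + e i - l) 0 ∂θ = ∫ x, max (ν i + x - l) 0 ∂F i := by
    intro i
    rw [← hθ.2 i, integral_map (measurable_pi_apply i).aemeasurable
      (by fun_prop : Continuous fun x : ℝ => max (ν i + x - l) 0).aestronglyMeasurable]
  simp only [excessBound, dualValue]
  rw [integral_add (integrable_const l) (integrable_finsetSum _ hint), integral_finsetSum _ hint,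
    integral_const, probReal_univ, one_smul]
  simp only [hmarginal]

theorem expectedMaxUtility_le_dualValue (hF : ∀ i, Integrable (fun x : ℝ => x) (F i))
    (hθ : θ ∈ jointLaws F) (hS : S.Nonempty) : expectedMaxUtility ν S θ ≤ dualValue F ν S l :=
  (integral_mono (integrable_iSup_utility hF hθ hS) (integrable_excessBound hF hθ)
    fun e => iSup_le_excessBound (u := fun i => ν i + e i) hS).trans_eq (integral_excessBound hF hθ)

theorem expectedMaxUtility_eq_dualValue_iff (hF : ∀ i, Integrable (fun x : ℝ => x) (F i))
    (hθ : θ ∈ jointLaws F) (hS : S.Nonempty) :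
    expectedMaxUtility ν S θ = dualValue F ν S l ↔
      ∀ᵐ e ∂θ, ⨆ i : S, (ν i + e i) = excessBound S l fun i => ν i + e i := by
  rw [← integral_excessBound hF hθ]
  exact integral_eq_iff_of_ae_le (integrable_iSup_utility hF hθ hS)
    (integrable_excessBound hF hθ)
    (ae_of_all _ fun e => iSup_le_excessBound (u := fun i => ν i + e i) hS)

theorem exists_mem_jointLaws_ae_existsUnique [∀ i, IsProbabilityMeasure (F i)]
    (hsum : ∑ i ∈ S, (1 - cdf (F i) (l - ν i)) = 1) :
    ∃ θ ∈ jointLaws F, ∀ᵐ e ∂θ, ∃! i, i ∈ S ∧ l < ν i + e i := by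
  have hA : ∀ i, MeasurableSet {x | i ∈ S ∧ l < ν i + x} := fun i =>
    (MeasurableSet.const _).inter (measurableSet_setOf_lt_add l _)
  have htail : ∑ i, F i {x | i ∈ S ∧ l < ν i + x} = 1 := by
    rw [← sum_measure_setOf_lt_add_eq_one hsum, ← Finset.sum_subset S.subset_univ]
    · exact Finset.sum_congr rfl fun i hi => by simp only [hi, true_and]
    · exact fun i _ hi => by simp [hi]
  obtain ⟨θ, hθ, hmap, hu⟩ := exists_map_eval_eq_and_ae_existsUnique_mem hA htail
  exact ⟨θ, ⟨hθ, hmap⟩, hu⟩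

theorem isMaxOn_expectedMaxUtility_iff [∀ i, IsProbabilityMeasure (F i)]
    (hF : ∀ i, Integrable (fun x : ℝ => x) (F i))
    (hsum : ∑ i ∈ S, (1 - cdf (F i) (l - ν i)) = 1) (hθ : θ ∈ jointLaws F) :
    IsMaxOn (expectedMaxUtility ν S) (jointLaws F) θ ↔
      ∀ᵐ e ∂θ, ∃! i, i ∈ S ∧ l < ν i + e i := by
  have hS : S.Nonempty := Finset.nonempty_of_sum_ne_zero (hsum ▸ one_ne_zero)
  have heq : ∀ {θ'}, θ' ∈ jointLaws F → (∀ᵐ e ∂θ', ∃! i, i ∈ S ∧ l < ν i + e i) →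
      expectedMaxUtility ν S θ' = dualValue F ν S l := fun hθ' hu =>
    (expectedMaxUtility_eq_dualValue_iff hF hθ' hS).2 (hu.mono fun _ => iSup_eq_excessBound)
  constructor
  · intro hmax
    obtain ⟨θ', hθ', hu⟩ := exists_mem_jointLaws_ae_existsUnique hsum
    have hopt : expectedMaxUtility ν S θ = dualValue F ν S l :=
      (expectedMaxUtility_le_dualValue hF hθ hS).antisymm ((heq hθ' hu).ge.trans (hmax hθ'))
    have := hθ.1
    refine ae_existsUnique_mem_of_sum_measure_eq_one
      (A := fun i => {e : Fin n → ℝ | l < ν i + e i})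
      (fun i _ => (measurableSet_setOf_lt_add l (ν i)).preimage
        (f := fun e : Fin n → ℝ => e i) (measurable_pi_apply i)) ?_ ?_
    · rw [← sum_measure_setOf_lt_add_eq_one hsum]
      exact Finset.sum_congr rfl fun i _ =>
        measure_eval_mem_of_mem_jointLaws hθ (measurableSet_setOf_lt_add l _)
    · filter_upwards [(expectedMaxUtility_eq_dualValue_iff hF hθ hS).1 hopt] with e he
      exact fun i hi j hj => eq_of_iSup_eq_excessBound (u := fun i => ν i + e i) he hi hj
  · intro hu θ' hθ'
    exact (expectedMaxUtility_le_dualValue hF hθ' hS).trans_eq (heq hθ hu).symm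

end Duality

section Representability

open Filter Topology

theorem exists_sum_one_sub_cdf_eq_one {ι : Type*} {F : ι → Measure ℝ}
    [∀ i, IsProbabilityMeasure (F i)] [∀ i, NullSingletonClass (F i)] {S : Finset ι}
    (hS : 1 < S.card) (ν : ι → ℝ) : ∃ l, ∑ i ∈ S, (1 - cdf (F i) (l - ν i)) = 1 := by
  have hcont : Continuous fun l => ∑ i ∈ S, (1 - cdf (F i) (l - ν i)) :=
    continuous_finsetSum _ fun i _ =>
      continuous_const.sub ((continuous_cdf (F i)).comp (continuous_sub_right (ν i)))
  have hbot : Tendsto (fun l => ∑ i ∈ S, (1 - cdf (F i) (l - ν i))) atBot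
      (𝓝 (∑ i ∈ S, (1 - 0))) :=
    tendsto_finsetSum _ fun i _ => tendsto_const_nhds.sub
      ((tendsto_cdf_atBot (F i)).comp (tendsto_atBot_add_const_right _ (-ν i) tendsto_id))
  have htop : Tendsto (fun l => ∑ i ∈ S, (1 - cdf (F i) (l - ν i))) atTop
      (𝓝 (∑ i ∈ S, (1 - 1))) :=
    tendsto_finsetSum _ fun i _ => tendsto_const_nhds.sub
      ((tendsto_cdf_atTop (F i)).comp (tendsto_atTop_add_const_right _ (-ν i) tendsto_id))
  obtain ⟨a, ha⟩ := (htop.eventually_lt_const (u := 1) (by simp)).exists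
  obtain ⟨b, hb⟩ := (hbot.eventually_const_lt (u := 1) (by simpa using hS)).exists
  exact mem_range_of_exists_le_of_exists_ge hcont ⟨a, ha.le⟩ ⟨b, hb.le⟩

theorem exists_cdf_eq_one_sub_choiceProb {n : ℕ} {F : Fin n → Measure ℝ} {ν : Fin n → ℝ}
    {S : Finset (Fin n)} {θ : Measure (Fin n → ℝ)} (hF : ∀ i, IsAdmissibleMarginal (F i))
    (hθ : θ ∈ jointLaws F) (hmax : IsMaxOn (expectedMaxUtility ν S) (jointLaws F) θ)
    (hS : 1 < S.card) : ∃ l, ∀ i ∈ S, cdf (F i) (l - ν i) = 1 - choiceProb ν S θ i := by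
  have := fun i => (hF i).isProbabilityMeasure
  have := fun i => (hF i).nullSingletonClass
  obtain ⟨l, hl⟩ := exists_sum_one_sub_cdf_eq_one (F := F) hS ν
  have hu := (isMaxOn_expectedMaxUtility_iff (fun i => (hF i).integrable) hl hθ).1 hmax
  exact ⟨l, fun i hi => by rw [choiceProb_eq_one_sub_cdf hθ hu hi, sub_sub_cancel]⟩

section LowThresholds

variable {ι : Type*} {F : ι → Measure ℝ} {ν q : ι → ℝ} {S : Finset ι} {i : ι} {x : ℝ}

/-- The thresholds `x` at which every utility `ν i + ε i` with `i ∈ S` exceeds `x` with probability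
at least `q i`. It stands in for the threshold at which these probabilities equal `q i`, which need
not exist if some `q i` is `1`. -/
def lowThresholds (F : ι → Measure ℝ) (ν q : ι → ℝ) (S : Finset ι) : LowerSet ℝ where
  carrier := {x | ∀ i ∈ S, cdf (F i) (x - ν i) ≤ 1 - q i}
  lower' _ _ hyx hx i hi :=
    (monotone_cdf (F i) (sub_le_sub_right hyx (ν i))).trans (hx i hi)

theorem mem_lowThresholds : x ∈ lowThresholds F ν q S ↔ ∀ i ∈ S, cdf (F i) (x - ν i) ≤ 1 - q i :=
  Iff.rfl

theorem mem_lowThresholds_iff_of_pos (hF : IsAdmissibleMarginal (F i)) (hq : ∀ j ∈ S, 0 ≤ q j)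
    (hsum : ∑ j ∈ S, q j = 1) (hl : q i < 1 → ∃ l, ∀ j ∈ S, cdf (F j) (l - ν j) = 1 - q j)
    (hi : i ∈ S) (hpos : 0 < q i) :
    x ∈ lowThresholds F ν q S ↔ cdf (F i) (x - ν i) ≤ 1 - q i := by
  refine ⟨fun hx => hx i hi, fun hx j hj => ?_⟩
  have hle : q i ≤ 1 := hsum ▸ Finset.single_le_sum hq hi
  rcases hle.lt_or_eq with hlt | hone
  · obtain ⟨l, hl⟩ := hl hlt
    have hxl : x ≤ l := by
      by_contra! hlx
      have := hF.cdf_lt_cdf (sub_lt_sub_right hlx (ν i)) (by rw [hl i hi]; linarith)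
        (by rw [hl i hi]; linarith)
      linarith [hl i hi]
    exact (monotone_cdf (F j) (sub_le_sub_right hxl (ν j))).trans (hl j hj).le
  · rcases eq_or_ne j i with rfl | hji
    · exact hx
    · have hqj : q j ≤ 0 := by
        classical
        rw [← Finset.add_sum_erase S q hi, hone, add_eq_left] at hsum
        rw [← hsum]
        exact Finset.single_le_sum (fun k hk => hq k (Finset.mem_of_mem_erase hk))
          (Finset.mem_erase.2 ⟨hji, hj⟩)
      linarith [cdf_le_one (F j) (x - ν j)]

end LowThresholds

variable {n : ℕ} {𝒮 : Finset (Finset (Fin n))} {p : Fin n → Finset (Fin n) → ℝ}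
  {S : Finset (Fin n)} {i : Fin n}

theorem IsChoiceData.le_one (hp : IsChoiceData 𝒮 p) (hS : S ∈ 𝒮) (hi : i ∈ S) : p i S ≤ 1 :=
  (hp S hS).2 ▸ Finset.single_le_sum (f := fun i => p i S) (hp S hS).1 hi

theorem IsChoiceData.one_lt_card (hp : IsChoiceData 𝒮 p) (hS : S ∈ 𝒮) (hi : i ∈ S)
    (hlt : p i S < 1) : 1 < S.card := by
  by_contra! hcard
  have hsum := (hp S hS).2
  rw [Finset.sum_eq_single_of_mem i hi fun j hj hji =>
    absurd (Finset.card_le_one.1 hcard j hj i hi) hji] at hsum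
  exact hlt.ne hsum

theorem MDMRepresentable.exists_orderCompatible (hp : IsChoiceData 𝒮 p)
    (h : MDMRepresentable 𝒮 p) : ∃ lam : 𝒮 → ℝ, OrderCompatible 𝒮 p lam := by
  obtain ⟨F, ν, hF, h⟩ := h
  have hthreshold : ∀ S ∈ 𝒮, ∀ i ∈ S, p i S < 1 →
      ∃ l, ∀ j ∈ S, cdf (F j) (l - ν j) = 1 - p j S := by
    intro S hS i hi hlt
    obtain ⟨θ, hθ, hmax, hc⟩ := h S hS
    obtain ⟨l, hl⟩ := exists_cdf_eq_one_sub_choiceProb hF hθ hmax (hp.one_lt_card hS hi hlt)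
    exact ⟨l, fun j hj => by rw [hl j hj, hc j hj]⟩
  have hmem : ∀ S ∈ 𝒮, ∀ i ∈ S, 0 < p i S → ∀ x,
      x ∈ lowThresholds F ν (p · S) S ↔ cdf (F i) (x - ν i) ≤ 1 - p i S := fun S hS i hi hpos x =>
    mem_lowThresholds_iff_of_pos (hF i) (hp S hS).1 (hp S hS).2 (hthreshold S hS i hi) hi hpos
  suffices OrderCompatible 𝒮 p fun S => lowThresholds F ν (p · S.1) S.1 from this.exists_real
  refine fun S T i hiS hiT => ⟨fun hlt => ?_, fun heq hne => ?_⟩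
  · obtain ⟨l, hl⟩ := hthreshold S.1 S.2 i hiS (hlt.trans_le (hp.le_one T.2 hiT))
    have hlS : l ∈ lowThresholds F ν (p · S.1) S.1 := fun j hj => (hl j hj).le
    have hlT : l ∉ lowThresholds F ν (p · T.1) T.1 := fun hl' => by
      linarith [hl i hiS, mem_lowThresholds.1 hl' i hiT]
    exact not_le.1 fun hle => hlT (hle hlS)
  · have hpos : 0 < p i S.1 := ((hp S.1 S.2).1 i hiS).lt_of_ne' hne
    ext x
    exact (hmem S.1 S.2 i hiS hpos x).trans
      (heq ▸ (hmem T.1 T.2 i hiT (heq ▸ hpos) x).symm)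

theorem OrderCompatible.exists_marginal (hp : IsChoiceData 𝒮 p) {lam : 𝒮 → ℝ}
    (h : OrderCompatible 𝒮 p lam) (i : Fin n) : ∃ μ : Measure ℝ, IsAdmissibleMarginal μ ∧
      ∀ S : 𝒮, i ∈ S.1 → cdf μ (lam S) = 1 - p i S.1 := by
  obtain ⟨μ, hμ, hcdf⟩ := exists_isAdmissibleMarginal_cdf_eq (ι := {S : 𝒮 // i ∈ S.1})
    (x := fun S => lam S.1) (q := fun S => 1 - p i S.1)
    (fun S => sub_nonneg.2 (hp.le_one S.1.2 S.2))
    (fun S => sub_le_self 1 ((hp S.1 S.1.2).1 i S.2))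
    (fun S T hST => (h T.1 S.1 i T.2 S.2).1 (by linarith))
    (fun S T hST hne => (h S.1 T.1 i S.2 T.2).2 (by linarith) fun h0 => hne (by rw [h0, sub_zero]))
  exact ⟨μ, hμ, fun S hS => hcdf ⟨S, hS⟩⟩

theorem OrderCompatible.mdmRepresentable (hp : IsChoiceData 𝒮 p) {lam : 𝒮 → ℝ}
    (h : OrderCompatible 𝒮 p lam) : MDMRepresentable 𝒮 p := by
  choose F hF hcdf using h.exists_marginal hp
  have := fun i => (hF i).isProbabilityMeasure
  refine ⟨F, 0, hF, fun S hS => ?_⟩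
  have htail : ∀ i ∈ S, 1 - cdf (F i) (lam ⟨S, hS⟩ - (0 : Fin n → ℝ) i) = p i S := fun i hi => by
    rw [Pi.zero_apply, sub_zero, hcdf i ⟨S, hS⟩ hi, sub_sub_cancel]
  have hsum : ∑ i ∈ S, (1 - cdf (F i) (lam ⟨S, hS⟩ - (0 : Fin n → ℝ) i)) = 1 := by
    rw [Finset.sum_congr rfl htail, (hp S hS).2]
  obtain ⟨θ, hθ, hu⟩ := exists_mem_jointLaws_ae_existsUnique hsum
  refine ⟨θ, hθ, (isMaxOn_expectedMaxUtility_iff (fun i => (hF i).integrable) hsum hθ).2 hu,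
    fun i hi => ?_⟩
  rw [choiceProb_eq_one_sub_cdf hθ hu hi, htail i hi]

theorem mdmRepresentable_iff_exists_orderCompatible (hp : IsChoiceData 𝒮 p) :
    MDMRepresentable 𝒮 p ↔ ∃ lam : 𝒮 → ℝ, OrderCompatible 𝒮 p lam :=
  ⟨fun h => h.exists_orderCompatible hp, fun ⟨_, h⟩ => h.mdmRepresentable hp⟩

end Representability

theorem theorem1 (n : ℕ) (𝒮 : Finset (Finset (Fin n))) (p : Fin n → Finset (Fin n) → ℝ)
    (hp : IsChoiceData 𝒮 p) :
    (MDMRepresentable 𝒮 p ↔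
      ∃ lam : 𝒮 → ℝ, ∀ (S T : 𝒮) (i : Fin n), i ∈ S.1 → i ∈ T.1 →
        (p i S.1 < p i T.1 → lam T < lam S) ∧
        (p i S.1 = p i T.1 → p i S.1 ≠ 0 → lam S = lam T)) ∧
    (MDMRepresentable 𝒮 p ↔ 0 < (mdmProgram 𝒮 p).optimalValue) ∧
    (mdmProgram 𝒮 p).numVariables = 𝒮.card + 1 ∧
    (mdmProgram 𝒮 p).numConstraints ≤ n * 𝒮.card :=
  have h := mdmRepresentable_iff_exists_orderCompatible hp
  ⟨h, h.trans (exists_orderCompatible_iff_optimalValue_pos fun S => (hp S.1 S.2).1),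
    numVariables_mdmProgram, numConstraints_mdmProgram_le⟩
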